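/- Let $\alpha\in[0,1)$. For a connected simple graph $G$ with distance function $d_G$, let $D(G)=(d_G(u,v))_{u,v\in V(G)}$ be its distance matrix, let $T(G)$ be the diagonal matrix whose entry at a vertex $u$ is the transmission $T_G(u)=\sum_{v\in V(G)}d_G(u,v)$, and let $D_\alpha(G)=\alpha T(G)+(1-\alpha)D(G)$. The distance $\alpha$-spectral radius $\mu_\alpha(G)$ is the largest eigenvalue of the real symmetric matrix $D_\alpha(G)$. For $n\ge 3$, let $Ki_{n,3}$ be the graph of order $n$ obtained from a triangle and a path $P_{n-3}$ by joining a vertex of the triangle to a terminal vertex of the path by an edge if $n>3$, and $Ki_{n,3}=K_3$ if $n=3$. A unicyclic graph is a connected graph that contains exactly one cycle; it is an odd-cycle unicyclic graph if the length of this cycle is odd. Theorem. Let $\alpha\in[0,1)$ and $n\ge 3$. The graph $Ki_{n,3}$ is an odd-cycle unicyclic graph, and for every odd-cycle unicyclic graph $G$ of order $n$, $$\mu_\alpha(G)\le\mu_\alpha(Ki_{n,3}),$$ with equality if and only if $G\cong Ki_{n,3}$. -/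

import Mathlib

/-- The transmission `T_G(u)` of a vertex `u`: the sum of the distances from `u` to all vertices. -/
noncomputable def transmission {V : Type*} [Fintype V] (G : SimpleGraph V) (u : V) : ℝ :=
  ∑ v, (G.dist u v : ℝ)

/-- The distance matrix `D(G)`. -/
noncomputable def distMatrix {V : Type*} (G : SimpleGraph V) : Matrix V V ℝ :=
  Matrix.of fun u v => (G.dist u v : ℝ)

/-- The matrix `D_α(G) = α T(G) + (1 - α) D(G)`, where `T(G)` is the diagonal matrix of vertex
transmissions. -/
noncomputable def distAlphaMatrix {V : Type*} [Fintype V] [DecidableEq V] (α : ℝ)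
    (G : SimpleGraph V) : Matrix V V ℝ :=
  α • Matrix.diagonal (transmission G) + (1 - α) • distMatrix G

theorem distAlphaMatrix_isHermitian {V : Type*} [Fintype V] [DecidableEq V] (α : ℝ)
    (G : SimpleGraph V) : (distAlphaMatrix α G).IsHermitian := by
  ext u v
  by_cases h : u = v
  · subst h
    simp
  · simp [distAlphaMatrix, distMatrix, Matrix.diagonal_apply_ne _ h,
      Matrix.diagonal_apply_ne _ (Ne.symm h), SimpleGraph.dist_comm]

/-- The distance `α`-spectral radius `μ_α(G)`: the largest eigenvalue of the real symmetric matrix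
`D_α(G)`. -/
noncomputable def distAlphaSpectralRadius {V : Type*} [Fintype V] [DecidableEq V] (α : ℝ)
    (G : SimpleGraph V) : ℝ :=
  sSup (spectrum ℝ (distAlphaMatrix α G))

/-- On a nonempty vertex set the supremum in `distAlphaSpectralRadius` is attained: it really is
the largest eigenvalue. -/
theorem distAlphaSpectralRadius_isGreatest {V : Type*} [Fintype V] [DecidableEq V] [Nonempty V]
    (α : ℝ) (G : SimpleGraph V) :
    IsGreatest (spectrum ℝ (distAlphaMatrix α G)) (distAlphaSpectralRadius α G) := by
  have h := (distAlphaMatrix_isHermitian α G).spectrum_real_eq_range_eigenvalues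
  have hfin : (spectrum ℝ (distAlphaMatrix α G)).Finite := h ▸ Set.finite_range _
  have hne : (spectrum ℝ (distAlphaMatrix α G)).Nonempty := h ▸ Set.range_nonempty _
  exact ⟨hne.csSup_mem hfin, fun x hx => le_csSup hfin.bddAbove hx⟩

/-- `C` is a cycle of `G`, as a subgraph: the subgraph traced out by some closed walk that is a
cycle. (Thus the choice of a starting vertex and of a direction does not matter.) -/
def IsCycleOf {V : Type*} (G : SimpleGraph V) (C : G.Subgraph) : Prop :=
  ∃ (u : V) (c : G.Walk u u), c.IsCycle ∧ c.toSubgraph = C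

/-- A unicyclic graph: a connected graph with exactly one cycle. -/
def IsUnicyclic {V : Type*} (G : SimpleGraph V) : Prop :=
  G.Connected ∧ ∃! C : G.Subgraph, IsCycleOf G C

/-- An odd-cycle graph: every cycle has odd length. For a unicyclic graph this says that its unique
cycle has odd length. -/
def IsOddCycleGraph {V : Type*} (G : SimpleGraph V) : Prop :=
  ∀ (u : V) (c : G.Walk u u), c.IsCycle → Odd c.length

/-- The graph `Ki_{n,ω}` (for `2 ≤ ω ≤ n`): the vertices `0, …, ω - 1` form a complete graph,
the vertices `ω, …, n - 1` form a path in this order, and if `ω < n` then `ω - 1` is adjacent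
to `ω`. -/
def kiteGraph (n ω : ℕ) : SimpleGraph (Fin n) where
  Adj i j := i ≠ j ∧
    ((i.val < ω ∧ j.val < ω) ∨ i.val + 1 = j.val ∨ j.val + 1 = i.val)
  symm := ⟨fun i j h => ⟨h.1.symm, by
    rcases h.2 with ⟨h1, h2⟩ | h1 | h1
    · exact Or.inl ⟨h2, h1⟩
    · exact Or.inr (Or.inr h1)
    · exact Or.inr (Or.inl h1)⟩⟩
  loopless := ⟨fun _ h => h.1 rfl⟩

/-! At a positive vector `x` attaining the spectral radius, μ_α(G)·(x ⬝ᵥ x) is the sum of the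
distances d(u,v) over ordered pairs, with positive weights αx_u² + (1-α)x_u x_v. It therefore
suffices to show, for arbitrary positive weights, that the vertices can be laid out on a kite with a
strictly larger weighted distance sum, unless the distances already are those of a kite. This
combinatorial claim is `IsKiteDominated`; the layout may depend on the weights.

The claim is proved by growing a vertex set, always with the distances of G. For the cycle
(`isKiteDominated_of_odd_cycle`), twice the distance is at most the sum of two kite distances, so
one of the two kites does at least as well. When a vertex adjacent to the set is added
(`isKiteDominated_insert`), its weights are folded onto its neighbour; the induction hypothesis then
gives a kite with an extra leaf. `exists_arrangement_of_leaf` turns this into a longer kite, again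
by bounding distances by convex combinations of kite distances.

`radius_lt_or_iso_kiteGraph` carries `x` along the layout and applies the Rayleigh bound on the
kite. -/

/-! ### Explicit distances in a kite and in a kite with a leaf -/

/-- The distance between the vertices `a` and `b` of the graphs `Ki_{n,3}`. -/
def kiteDist (a b : ℕ) : ℕ :=
  if a = b then 0
  else if a = 0 then (if b = 1 then 1 else b - 1)
  else if b = 0 then (if a = 1 then 1 else a - 1)
  else (a - b) + (b - a)

/-- The distance obtained from `kiteDist` on `0, …, k - 1` by attaching a new vertex `k` to the
vertex `i`. -/
def kiteLeafDist (k i a b : ℕ) : ℕ :=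
  if a = b then 0 else if a = k then 1 + kiteDist i b else if b = k then 1 + kiteDist i a
  else kiteDist a b

/-- Linear case description in the form that `omega` can consume. -/
theorem kiteDist_spec (a b : ℕ) : (a = b ∧ kiteDist a b = 0) ∨
    (a = 0 ∧ b = 1 ∧ kiteDist a b = 1) ∨ (a = 1 ∧ b = 0 ∧ kiteDist a b = 1) ∨
    (a = 0 ∧ 2 ≤ b ∧ kiteDist a b + 1 = b) ∨ (b = 0 ∧ 2 ≤ a ∧ kiteDist a b + 1 = a) ∨
    (1 ≤ a ∧ a < b ∧ kiteDist a b + a = b) ∨ (1 ≤ b ∧ b < a ∧ kiteDist a b + b = a) := by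
  unfold kiteDist; split_ifs <;> omega

theorem kiteDist_comm (a b : ℕ) : kiteDist a b = kiteDist b a := by
  have := kiteDist_spec a b
  have := kiteDist_spec b a
  omega

@[simp] theorem kiteLeafDist_self (k i a : ℕ) : kiteLeafDist k i a a = 0 := if_pos rfl

theorem kiteLeafDist_left {k i b : ℕ} (hb : b ≠ k) :
    kiteLeafDist k i k b = 1 + kiteDist i b := by
  simp [kiteLeafDist, hb.symm]

theorem kiteLeafDist_right {k i a : ℕ} (ha : a ≠ k) :
    kiteLeafDist k i a k = 1 + kiteDist i a := by
  simp [kiteLeafDist, ha]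

theorem kiteLeafDist_of_ne {k i a b : ℕ} (ha : a ≠ k) (hb : b ≠ k) :
    kiteLeafDist k i a b = kiteDist a b := by
  by_cases h : a = b
  · simp [h, kiteDist]
  · simp [kiteLeafDist, ha, hb, h]

theorem kiteLeafDist_comm (k i a b : ℕ) : kiteLeafDist k i a b = kiteLeafDist k i b a := by
  by_cases h : a = b
  · rw [h]
  by_cases ha : a = k
  · subst ha; rw [kiteLeafDist_left (Ne.symm h), kiteLeafDist_right (Ne.symm h)]
  by_cases hb : b = k
  · subst hb; rw [kiteLeafDist_left h, kiteLeafDist_right h]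
  rw [kiteLeafDist_of_ne ha hb, kiteLeafDist_of_ne hb ha, kiteDist_comm]

/-- A leaf at the free end of the path only lengthens the path; `3 ≤ k` ensures that this end is not
the vertex `1`, whose leaf would not give this labelling. -/
theorem kiteLeafDist_last {k a b : ℕ} (hk : 3 ≤ k) (ha : a ≤ k) (hb : b ≤ k) :
    kiteLeafDist k (k - 1) a b = kiteDist a b := by
  wlog hab : a ≤ b generalizing a b
  · rw [kiteLeafDist_comm, kiteDist_comm]; exact this hb ha (by omega)
  rcases hb.eq_or_lt with rfl | hb'
  · rcases hab.eq_or_lt with rfl | h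
    · simp [kiteDist]
    · rw [kiteLeafDist_right h.ne]
      have := kiteDist_spec (b - 1) a
      have := kiteDist_spec a b
      omega
  · exact kiteLeafDist_of_ne (by omega) hb'.ne

/-! ### Weighted distance sums and averaging -/

section WeightedSum

variable {V : Type*}

/-- The sum of `m` over the pairs in `S`, weighted by `Q`. -/
def weightedSum (S : Finset V) (Q : V → V → ℝ) (m : V → V → ℕ) : ℝ :=
  ∑ u ∈ S, ∑ v ∈ S, Q u v * m u v

theorem weightedSum_congr {S : Finset V} {Q : V → V → ℝ} {m m' : V → V → ℕ}
    (h : ∀ u ∈ S, ∀ v ∈ S, m u v = m' u v) : weightedSum S Q m = weightedSum S Q m' :=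
  Finset.sum_congr rfl fun u hu => Finset.sum_congr rfl fun v hv => by rw [h u hu v hv]

theorem weightedSum_le {S : Finset V} {Q : V → V → ℝ} (hQ : ∀ u v, 0 < Q u v) {m m' : V → V → ℕ}
    (h : ∀ u ∈ S, ∀ v ∈ S, m u v ≤ m' u v) : weightedSum S Q m ≤ weightedSum S Q m' :=
  Finset.sum_le_sum fun u hu => Finset.sum_le_sum fun v hv =>
    mul_le_mul_of_nonneg_left (by exact_mod_cast h u hu v hv) (hQ u v).le

theorem weightedSum_lt {S : Finset V} {Q : V → V → ℝ} (hQ : ∀ u v, 0 < Q u v) {m m' : V → V → ℕ}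
    (h : ∀ u ∈ S, ∀ v ∈ S, m u v ≤ m' u v) (hlt : ∃ u ∈ S, ∃ v ∈ S, m u v < m' u v) :
    weightedSum S Q m < weightedSum S Q m' := by
  obtain ⟨a, ha, b, hb, hab⟩ := hlt
  have key : ∀ u ∈ S, ∀ v ∈ S, Q u v * m u v ≤ Q u v * m' u v := fun u hu v hv =>
    mul_le_mul_of_nonneg_left (by exact_mod_cast h u hu v hv) (hQ u v).le
  refine Finset.sum_lt_sum (fun u hu => Finset.sum_le_sum (key u hu)) ⟨a, ha, ?_⟩
  exact Finset.sum_lt_sum (key a ha)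
    ⟨b, hb, mul_lt_mul_of_pos_left (by exact_mod_cast hab) (hQ a b)⟩

theorem weightedSum_add (S : Finset V) (Q : V → V → ℝ) (m m' : V → V → ℕ) :
    weightedSum S Q (fun u v => m u v + m' u v) = weightedSum S Q m + weightedSum S Q m' := by
  simp only [weightedSum, ← Finset.sum_add_distrib]
  refine Finset.sum_congr rfl fun u _ => Finset.sum_congr rfl fun v _ => ?_
  push_cast; ring

theorem weightedSum_const_mul (S : Finset V) (Q : V → V → ℝ) (p : ℕ) (m : V → V → ℕ) :
    weightedSum S Q (fun u v => p * m u v) = p * weightedSum S Q m := by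
  simp only [weightedSum, Finset.mul_sum]
  refine Finset.sum_congr rfl fun u _ => Finset.sum_congr rfl fun v _ => ?_
  push_cast; ring

/-- Averaging: a quantity bounded by a weighted mean of two others cannot exceed both. -/
theorem weightedSum_le_of_convex {S : Finset V} {Q : V → V → ℝ} (hQ : ∀ u v, 0 < Q u v)
    {m m₁ m₂ : V → V → ℕ} (p q : ℕ) (hpq : 0 < p + q)
    (h : ∀ u ∈ S, ∀ v ∈ S, (p + q) * m u v ≤ p * m₁ u v + q * m₂ u v) :
    weightedSum S Q m ≤ weightedSum S Q m₁ ∨ weightedSum S Q m ≤ weightedSum S Q m₂ := by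
  have := weightedSum_le hQ h
  simp only [weightedSum_add, weightedSum_const_mul] at this
  push_cast at this
  have hpq' : (0 : ℝ) < p + q := by exact_mod_cast hpq
  by_contra! hc
  rcases Nat.eq_zero_or_pos p with rfl | hp
  · have hq : (0 : ℝ) < q := by simpa using hpq'
    nlinarith [hc.2]
  · have hp' : (0 : ℝ) < p := by exact_mod_cast hp
    nlinarith [mul_lt_mul_of_pos_left hc.1 hp', mul_le_mul_of_nonneg_left hc.2.le q.cast_nonneg]

theorem weightedSum_lt_of_convex {S : Finset V} {Q : V → V → ℝ} (hQ : ∀ u v, 0 < Q u v)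
    {m m₁ m₂ : V → V → ℕ} (p q : ℕ)
    (h : ∀ u ∈ S, ∀ v ∈ S, (p + q) * m u v ≤ p * m₁ u v + q * m₂ u v)
    (hlt : ∃ u ∈ S, ∃ v ∈ S, (p + q) * m u v < p * m₁ u v + q * m₂ u v) :
    weightedSum S Q m < weightedSum S Q m₁ ∨ weightedSum S Q m < weightedSum S Q m₂ := by
  have := weightedSum_lt hQ h hlt
  simp only [weightedSum_add, weightedSum_const_mul] at this
  push_cast at this
  by_contra! hc
  nlinarith [mul_le_mul_of_nonneg_left hc.1 p.cast_nonneg,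
    mul_le_mul_of_nonneg_left hc.2 q.cast_nonneg]

theorem weightedSum_insert [DecidableEq V] {S : Finset V} {l : V} (hl : l ∉ S) (Q : V → V → ℝ)
    (m : V → V → ℕ) (hm : m l l = 0) :
    weightedSum (insert l S) Q m =
      weightedSum S Q m + ∑ v ∈ S, (Q l v * m l v + Q v l * m v l) := by
  simp only [weightedSum, Finset.sum_insert hl, hm, Finset.sum_add_distrib]
  push_cast; ring

/-- The extra weight in row `p` simulates a leaf at `p`: up to a constant, the leaf's distances are
those of `p`. -/
theorem weightedSum_fold [DecidableEq V] {S : Finset V} {p : V} (hp : p ∈ S) (Q : V → V → ℝ)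
    (w : V → ℝ) (m : V → V → ℕ) :
    weightedSum S (fun u v => Q u v + if u = p then w v else 0) m =
      weightedSum S Q m + ∑ v ∈ S, w v * m p v := by
  simp only [weightedSum, add_mul, Finset.sum_add_distrib]
  congr 1
  rw [Finset.sum_eq_single_of_mem p hp]
  · simp
  · intro u _ hu; simp [hu]

end WeightedSum

/-! ### Domination by kites: leaves and odd cycles -/

section Domination

variable {V : Type*}

/-- For all positive weights, some arrangement of `S` as a kite has a larger weighted distance sum
than `d`, unless `d` is itself the distance of a kite. -/
def IsKiteDominated (d : V → V → ℕ) (S : Finset V) : Prop :=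
  ∀ Q : V → V → ℝ, (∀ u v, 0 < Q u v) → ∃ pos : V → ℕ,
    Set.InjOn pos S ∧ (∀ u ∈ S, pos u < S.card) ∧
    ((∀ u ∈ S, ∀ v ∈ S, d u v = kiteDist (pos u) (pos v)) ∨
      weightedSum S Q d < weightedSum S Q fun u v => kiteDist (pos u) (pos v))

theorem exists_mem_pos_eq {S : Finset V} {pos : V → ℕ} (hinj : Set.InjOn pos S)
    (hlt : ∀ u ∈ S, pos u < S.card) {a : ℕ} (ha : a < S.card) : ∃ u ∈ S, pos u = a := by
  classical
  have : S.image pos = Finset.range S.card := by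
    apply Finset.eq_of_subset_of_card_le
    · intro x hx
      obtain ⟨u, hu, rfl⟩ := Finset.mem_image.1 hx
      exact Finset.mem_range.2 (hlt u hu)
    · rw [Finset.card_image_of_injOn hinj, Finset.card_range]
  have h : a ∈ S.image pos := this ▸ Finset.mem_range.2 ha
  simpa using h

/-- The attaching point `p + 1` lies on the path from `1` to `p + q + 1`, at distances `p` and `q`
from its ends. Distance to a fixed vertex is convex along this path, so sliding the leaf to the two
ends with weights `q` and `p` does not decrease the mean. -/
theorem kiteLeafDist_convex_end (p q a b : ℕ) (ha : a ≤ p + q + 2) (hb : b ≤ p + q + 2) :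
    (p + q) * kiteLeafDist (p + q + 2) (p + 1) a b ≤
      p * kiteDist a b + q * kiteLeafDist (p + q + 2) 1 a b := by
  have key : ∀ b < p + q + 2, (p + q) * (1 + kiteDist (p + 1) b) ≤
      p * kiteDist (p + q + 2) b + q * (1 + kiteDist 1 b) := by
    intro b hb
    have h1 := kiteDist_spec (p + 1) b
    have h2 := kiteDist_spec (p + q + 2) b
    have h3 := kiteDist_spec 1 b
    rcases b with _ | c
    · rw [show kiteDist (p + q + 2) 0 = p + q + 1 by omega, show kiteDist 1 0 = 1 by omega]
      rcases p with _ | p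
      · rw [show kiteDist (0 + 1) 0 = 1 by omega]; nlinarith
      · rw [show kiteDist (p + 1 + 1) 0 = p + 1 by omega]; nlinarith
    · rw [show kiteDist 1 (c + 1) = c by omega]
      -- The fixed vertex `c + 1` lies on one side or the other of the attaching point `p + 1`.
      rcases le_total c p with h | h
      · obtain ⟨e, rfl⟩ := Nat.exists_eq_add_of_le h
        rw [show kiteDist (c + e + 1) (c + 1) = e by omega,
          show kiteDist (c + e + q + 2) (c + 1) = e + q + 1 by omega]
        nlinarith
      · obtain ⟨e, rfl⟩ := Nat.exists_eq_add_of_le h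
        obtain ⟨f, rfl⟩ := Nat.exists_eq_add_of_le (show e ≤ q by omega)
        rw [show kiteDist (p + 1) (p + e + 1) = e by omega,
          show kiteDist (p + (e + f) + 2) (p + e + 1) = f + 1 by omega]
        nlinarith
  wlog hab : a ≤ b generalizing a b
  · rw [kiteLeafDist_comm, kiteDist_comm a, kiteLeafDist_comm _ 1]
    exact this b a hb ha (by omega)
  rcases hab.eq_or_lt with rfl | hlt
  · simp
  rcases hb.eq_or_lt with rfl | hb'
  · rw [kiteLeafDist_right hlt.ne, kiteLeafDist_right hlt.ne, kiteDist_comm a]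
    exact key a hlt
  · rw [kiteLeafDist_of_ne (by omega) hb'.ne, kiteLeafDist_of_ne (by omega) hb'.ne, add_mul]

/-- The relabelling that moves the last vertex next to the first one. -/
def shiftLast (k a : ℕ) : ℕ := if a = 0 then 0 else if a = k then 1 else a + 1

theorem shiftLast_spec (k a : ℕ) : (a = 0 ∧ shiftLast k a = 0) ∨
    (0 < a ∧ a = k ∧ shiftLast k a = 1) ∨ (0 < a ∧ a ≠ k ∧ shiftLast k a = a + 1) := by
  unfold shiftLast; split_ifs <;> omega

/-- The relabelling that reverses the order of `1, …, k - 1`. -/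
def reverseInner (k a : ℕ) : ℕ := if a = 0 then 0 else if a = k then k else k - a

theorem reverseInner_spec (k a : ℕ) : (a = 0 ∧ reverseInner k a = 0) ∨
    (0 < a ∧ a = k ∧ reverseInner k a = k) ∨ (0 < a ∧ a ≠ k ∧ reverseInner k a = k - a) := by
  unfold reverseInner; split_ifs <;> omega

/-- With the leaf at `1`, the leaf followed by `1, …, k - 1` is a geodesic path, and both
relabellings keep its internal distances. Only vertex `0` moves: `shiftLast` puts it in a triangle
with the leaf and `1`, `reverseInner` in a triangle at the far end. The first move loses one unit to
the leaf, which the weight-one second move exactly recovers. -/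
theorem kiteLeafDist_convex_one (q a b : ℕ) (ha : a ≤ q + 3) (hb : b ≤ q + 3) :
    (q + 1) * kiteLeafDist (q + 3) 1 a b ≤
      q * kiteDist (shiftLast (q + 3) a) (shiftLast (q + 3) b) +
      1 * kiteDist (reverseInner (q + 3) a) (reverseInner (q + 3) b) := by
  wlog hab : a ≤ b generalizing a b
  · rw [kiteLeafDist_comm, kiteDist_comm (shiftLast _ _), kiteDist_comm (reverseInner _ _)]
    exact this b a hb ha (by omega)
  rcases hab.eq_or_lt with rfl | hlt
  · simp
  have s2 := kiteDist_spec (shiftLast (q + 3) a) (shiftLast (q + 3) b)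
  have s3 := kiteDist_spec (reverseInner (q + 3) a) (reverseInner (q + 3) b)
  have s4 := kiteDist_spec 1 a
  have s5 := kiteDist_spec a b
  have r1 := shiftLast_spec (q + 3) a
  have r2 := shiftLast_spec (q + 3) b
  have r3 := reverseInner_spec (q + 3) a
  have r4 := reverseInner_spec (q + 3) b
  rcases Nat.eq_zero_or_pos a with rfl | ha0
  · replace r1 : shiftLast (q + 3) 0 = 0 := by omega
    replace r3 : reverseInner (q + 3) 0 = 0 := by omega
    rcases hb.eq_or_lt with rfl | hb'
    · replace r2 : shiftLast (q + 3) (q + 3) = 1 := by omega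
      replace r4 : reverseInner (q + 3) (q + 3) = q + 3 := by omega
      rw [kiteLeafDist_right (by omega)]
      rw [r1, r2] at s2 ⊢
      rw [r3, r4] at s3 ⊢
      rw [show kiteDist 1 0 = 1 by omega, show kiteDist 0 1 = 1 by omega,
        show kiteDist 0 (q + 3) = q + 2 by omega]
      omega
    · replace r2 : shiftLast (q + 3) b = b + 1 := by omega
      replace r4 : reverseInner (q + 3) b = q + 3 - b := by omega
      rw [kiteLeafDist_of_ne (by omega) hb'.ne]
      rw [r1, r2] at s2 ⊢
      rw [r3, r4] at s3 ⊢
      rw [show kiteDist 0 (b + 1) = b by omega]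
      rcases (show b = 1 ∨ 2 ≤ b by omega) with rfl | hb2
      · rw [show kiteDist 0 1 = 1 by omega]; omega
      · obtain ⟨c, rfl⟩ := Nat.exists_eq_add_of_le' hb2
        rw [show kiteDist 0 (c + 2) = c + 1 by omega]
        have h1 : 1 ≤ kiteDist 0 (q + 3 - (c + 2)) := by omega
        have h2 : q - c ≤ kiteDist 0 (q + 3 - (c + 2)) := by omega
        have : c ≤ q := by omega
        obtain ⟨e, rfl⟩ := Nat.exists_eq_add_of_le this
        have h3 : e ≤ kiteDist 0 (c + e + 3 - (c + 2)) := by omega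
        nlinarith
  · have h : kiteLeafDist (q + 3) 1 a b =
        kiteDist (shiftLast (q + 3) a) (shiftLast (q + 3) b) ∧ kiteLeafDist (q + 3) 1 a b =
        kiteDist (reverseInner (q + 3) a) (reverseInner (q + 3) b) := by
      replace r1 : shiftLast (q + 3) a = a + 1 := by omega
      replace r3 : reverseInner (q + 3) a = q + 3 - a := by omega
      rcases hb.eq_or_lt with rfl | hb'
      · replace r2 : shiftLast (q + 3) (q + 3) = 1 := by omega
        replace r4 : reverseInner (q + 3) (q + 3) = q + 3 := by omega
        rw [kiteLeafDist_right (by omega)]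
        rw [r1, r2] at s2 ⊢
        rw [r3, r4] at s3 ⊢
        omega
      · replace r2 : shiftLast (q + 3) b = b + 1 := by omega
        replace r4 : reverseInner (q + 3) b = q + 3 - b := by omega
        rw [kiteLeafDist_of_ne (by omega) hb'.ne]
        rw [r1, r2] at s2 ⊢
        rw [r3, r4] at s3 ⊢
        omega
    rw [← h.1, ← h.2, add_mul]

/-- A leaf at the free end already gives a kite. An interior leaf is slid to the end or to `1`,
strictly improving one of the two, and a leaf at `1` is handled by moving vertex `0`. -/
theorem exists_arrangement_of_leaf {S : Finset V} {Q : V → V → ℝ} (hQ : ∀ u v, 0 < Q u v)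
    {pos : V → ℕ} {k i : ℕ} (hk : 3 ≤ k) (hcard : S.card = k + 1) (hinj : Set.InjOn pos S)
    (hlt : ∀ u ∈ S, pos u < S.card) (hi0 : 1 ≤ i) (hi : i < k) :
    ∃ pos' : V → ℕ, Set.InjOn pos' S ∧ (∀ u ∈ S, pos' u < S.card) ∧
      ((∀ u ∈ S, ∀ v ∈ S, kiteLeafDist k i (pos u) (pos v) = kiteDist (pos' u) (pos' v)) ∨
        weightedSum S Q (fun u v => kiteLeafDist k i (pos u) (pos v)) <
          weightedSum S Q fun u v => kiteDist (pos' u) (pos' v)) := by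
  have hle : ∀ u ∈ S, pos u ≤ k := fun u hu => by have := hlt u hu; omega
  have hcomp : ∀ g : ℕ → ℕ, (∀ a ≤ k, ∀ b ≤ k, g a = g b → a = b) → (∀ a ≤ k, g a ≤ k) →
      Set.InjOn (g ∘ pos) S ∧ ∀ u ∈ S, (g ∘ pos) u < S.card := fun g h1 h2 =>
    ⟨fun u hu v hv h => hinj hu hv (h1 _ (hle u hu) _ (hle v hv) h), fun u hu => by
      have := h2 _ (hle u hu); simp only [Function.comp]; omega⟩
  obtain ⟨hA, hA'⟩ := hcomp (shiftLast k)
    (fun a ha b hb h => by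
      have := shiftLast_spec k a
      have := shiftLast_spec k b
      omega)
    (fun a ha => by have := shiftLast_spec k a; omega)
  obtain ⟨hB, hB'⟩ := hcomp (reverseInner k)
    (fun a ha b hb h => by
      have := reverseInner_spec k a
      have := reverseInner_spec k b
      omega)
    (fun a ha => by have := reverseInner_spec k a; omega)
  have hone : ∃ pos' : V → ℕ, Set.InjOn pos' S ∧ (∀ u ∈ S, pos' u < S.card) ∧
      weightedSum S Q (fun u v => kiteLeafDist k 1 (pos u) (pos v)) ≤
        weightedSum S Q fun u v => kiteDist (pos' u) (pos' v) := by
    obtain ⟨q, rfl⟩ := Nat.exists_eq_add_of_le' hk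
    rcases weightedSum_le_of_convex hQ q 1 (by omega)
      (fun u hu v hv => kiteLeafDist_convex_one q _ _ (hle u hu) (hle v hv)) with h | h
    · exact ⟨_, hA, hA', h⟩
    · exact ⟨_, hB, hB', h⟩
  rcases (show i = k - 1 ∨ i + 1 < k by omega) with rfl | hik
  · refine ⟨pos, hinj, hlt, Or.inl fun u hu v hv => kiteLeafDist_last hk (hle u hu) (hle v hv)⟩
  rcases (show i = 1 ∨ 2 ≤ i by omega) with rfl | hi2
  -- A triangle with one leaf is already a kite; for `k > 3` the pair `0, 1` makes the inequality
  -- strict.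
  · rcases hk.eq_or_lt with rfl | hk4
    · refine ⟨_, hB, hB', Or.inl fun u hu v hv => ?_⟩
      have := hle u hu
      have := hle v hv
      simp only [Function.comp]
      generalize pos u = x at *
      generalize pos v = y at *
      interval_cases x <;> interval_cases y <;> rfl
    · obtain ⟨q, rfl⟩ := Nat.exists_eq_add_of_le' hk
      obtain ⟨a, ha, ha'⟩ := exists_mem_pos_eq hinj hlt (a := 0) (by omega)
      obtain ⟨b, hb, hb'⟩ := exists_mem_pos_eq hinj hlt (a := 1) (by omega)
      rcases weightedSum_lt_of_convex hQ q 1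
        (fun u hu v hv => kiteLeafDist_convex_one q _ _ (hle u hu) (hle v hv))
        ⟨a, ha, b, hb, by
          rw [ha', hb']
          have h1 : kiteLeafDist (q + 3) 1 0 1 = 1 := by
            rw [kiteLeafDist_of_ne (by omega) (by omega)]; rfl
          have h2 : kiteDist (shiftLast (q + 3) 0) (shiftLast (q + 3) 1) = 1 := by
            simp [shiftLast, kiteDist]
          have h3 : kiteDist (reverseInner (q + 3) 0) (reverseInner (q + 3) 1) = q + 1 := by
            simp [reverseInner, kiteDist]
          rw [h1, h2, h3]; omega⟩ with h | h
      · exact ⟨_, hA, hA', Or.inr h⟩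
      · exact ⟨_, hB, hB', Or.inr h⟩
  · obtain ⟨p, rfl⟩ := Nat.exists_eq_add_of_le' hi0
    obtain ⟨q, rfl⟩ := Nat.exists_eq_add_of_le (show p + 2 ≤ k by omega)
    rw [show p + 2 + q = p + q + 2 by omega] at *
    obtain ⟨a, ha, ha'⟩ := exists_mem_pos_eq hinj hlt (a := p + q + 2) (by omega)
    obtain ⟨b, hb, hb'⟩ := exists_mem_pos_eq hinj hlt (a := p + 1) (by omega)
    -- Strictness comes from the leaf and its attaching vertex, where the convex function has its
    -- kink.
    rcases weightedSum_lt_of_convex hQ p q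
      (fun u hu v hv => kiteLeafDist_convex_end p q _ _ (hle u hu) (hle v hv))
      ⟨a, ha, b, hb, by
        rw [ha', hb']
        have h1 := kiteDist_spec (p + 1) (p + 1)
        have h2 := kiteDist_spec (p + q + 2) (p + 1)
        have h3 := kiteDist_spec 1 (p + 1)
        rw [kiteLeafDist_left (by omega), kiteLeafDist_left (by omega),
          show kiteDist (p + 1) (p + 1) = 0 by omega, show kiteDist 1 (p + 1) = p by omega,
          show kiteDist (p + q + 2) (p + 1) = q + 1 by omega]
        have : 1 ≤ p := by omega
        have : 1 ≤ q := by omega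
        nlinarith⟩ with h | h
    · exact ⟨pos, hinj, hlt, Or.inr h⟩
    · obtain ⟨pos', h1, h2, h3⟩ := hone
      exact ⟨pos', h1, h2, Or.inr (h.trans_le h3)⟩

theorem isKiteDominated_insert [DecidableEq V] {d : V → V → ℕ} {S : Finset V} {l p : V}
    (h : IsKiteDominated d S) (hS : 3 ≤ S.card) (hl : l ∉ S) (hp : p ∈ S) (hdl : d l l = 0)
    (hd1 : ∀ v ∈ S, d l v ≤ 1 + d p v) (hd2 : ∀ v ∈ S, d v l ≤ 1 + d p v) :
    IsKiteDominated d (insert l S) := by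
  intro Q hQ
  set w : V → ℝ := fun v => Q l v + Q v l with hw
  have hwpos : ∀ v, 0 < w v := fun v => add_pos (hQ _ _) (hQ _ _)
  obtain ⟨pos, hinj, hlt, hcase⟩ := h (fun u v => Q u v + if u = p then w v else 0) (by
    intro u v
    have := hQ u v
    have := hwpos v
    split_ifs <;> linarith)
  have hcard : (insert l S).card = S.card + 1 := Finset.card_insert_of_notMem hl
  -- arrangements in which `p` does not come first
  obtain ⟨pos, hinj, hlt, hp1, hcase⟩ : ∃ pos : V → ℕ, Set.InjOn pos S ∧
      (∀ u ∈ S, pos u < S.card) ∧ 1 ≤ pos p ∧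
      ((∀ u ∈ S, ∀ v ∈ S, d u v = kiteDist (pos u) (pos v)) ∨
      weightedSum S (fun u v => Q u v + if u = p then w v else 0) d <
      weightedSum S (fun u v => Q u v + if u = p then w v else 0)
        fun u v => kiteDist (pos u) (pos v)) := by
    rcases Nat.eq_zero_or_pos (pos p) with h0 | h0
    -- Vertices `0` and `1` are twins in the kite, so exchanging them keeps every distance and frees
    -- position `0`.
    · have swap_spec : ∀ a : ℕ, (a = 0 ∧ Equiv.swap 0 1 a = 1) ∨
          (a = 1 ∧ Equiv.swap 0 1 a = 0) ∨ (2 ≤ a ∧ Equiv.swap 0 1 a = a) := by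
        intro a; rw [Equiv.swap_apply_def]; split_ifs <;> omega
      have hsw : ∀ a b, kiteDist (Equiv.swap 0 1 a) (Equiv.swap 0 1 b) = kiteDist a b := by
        intro a b
        have h1 := kiteDist_spec a b
        have h2 := kiteDist_spec (Equiv.swap 0 1 a) (Equiv.swap 0 1 b)
        have h3 := swap_spec a
        have h4 := swap_spec b
        omega
      refine ⟨fun v => Equiv.swap 0 1 (pos v), fun u hu v hv huv => hinj hu hv
        ((Equiv.swap 0 1).injective huv), fun u hu => ?_, by simp [h0], by simpa only [hsw]⟩
      have := hlt u hu
      have := swap_spec (pos u)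
      dsimp only
      omega
    · exact ⟨pos, hinj, hlt, h0, hcase⟩
  set k := S.card with hk
  set pos₁ : V → ℕ := fun v => if v = l then k else pos v with hpos₁
  have hpl : pos₁ l = k := by simp [hpos₁]
  have hpS : ∀ v ∈ S, pos₁ v = pos v := fun v hv => by
    simp [hpos₁, show v ≠ l by rintro rfl; exact hl hv]
  have hinj₁ : Set.InjOn pos₁ (insert l S : Finset V) := by
    intro u hu v hv huv
    rcases Finset.mem_insert.1 hu with hul | hu <;> rcases Finset.mem_insert.1 hv with hvl | hv
    · rw [hul, hvl]
    · rw [hul, hpl, hpS v hv] at huv; exact absurd huv (hlt v hv).ne'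
    · rw [hvl, hpl, hpS u hu] at huv; exact absurd huv (hlt u hu).ne
    · rw [hpS u hu, hpS v hv] at huv; exact hinj hu hv huv
  have hlt₁ : ∀ u ∈ insert l S, pos₁ u < (insert l S).card := by
    intro u hu
    rw [hcard]
    rcases Finset.mem_insert.1 hu with rfl | hu
    · rw [hpl]; omega
    · rw [hpS u hu]; have := hlt u hu; omega
  -- The intermediate comparison object: the kite on `S` with `l` hung as a leaf on `p`.
  set m : V → V → ℕ := fun u v => kiteLeafDist k (pos p) (pos₁ u) (pos₁ v) with hm
  have hmll : m l l = 0 := by simp [hm, kiteLeafDist]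
  have hml : ∀ v ∈ S, m l v = 1 + kiteDist (pos p) (pos v) := fun v hv => by
    simp only [hm, hpl, hpS v hv, kiteLeafDist_left (hlt v hv).ne]
  have hml' : ∀ v ∈ S, m v l = 1 + kiteDist (pos p) (pos v) := fun v hv => by
    simp only [hm, hpl, hpS v hv, kiteLeafDist_right (hlt v hv).ne]
  have hmS : ∀ u ∈ S, ∀ v ∈ S, m u v = kiteDist (pos u) (pos v) := fun u hu v hv => by
    simp only [hm, hpS u hu, hpS v hv, kiteLeafDist_of_ne (hlt u hu).ne (hlt v hv).ne]
  have hdm : (∀ u ∈ insert l S, ∀ v ∈ insert l S, d u v = m u v) ∨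
      weightedSum (insert l S) Q d < weightedSum (insert l S) Q m := by
    rcases hcase with heq | hstrict
    · have hle : ∀ u ∈ insert l S, ∀ v ∈ insert l S, d u v ≤ m u v := by
        intro u hu v hv
        rcases Finset.mem_insert.1 hu with hul | hu <;> rcases Finset.mem_insert.1 hv with hvl | hv
        · rw [hul, hvl, hdl]; exact Nat.zero_le _
        · rw [hul, hml v hv, ← heq p hp v hv]; exact hd1 v hv
        · rw [hvl, hml' u hu, ← heq p hp u hu]; exact hd2 u hu
        · rw [hmS u hu v hv, heq u hu v hv]
      by_cases hall : ∀ u ∈ insert l S, ∀ v ∈ insert l S, d u v = m u v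
      · exact Or.inl hall
      · push Not at hall
        obtain ⟨u, hu, v, hv, huv⟩ := hall
        exact Or.inr (weightedSum_lt hQ hle ⟨u, hu, v, hv, lt_of_le_of_ne (hle u hu v hv) huv⟩)
    · right
      rw [weightedSum_insert hl Q d hdl, weightedSum_insert hl Q m hmll]
      rw [weightedSum_fold hp, weightedSum_fold hp] at hstrict
      have e1 : ∑ v ∈ S, (Q l v * (d l v : ℝ) + Q v l * (d v l : ℝ)) ≤
          ∑ v ∈ S, (w v + w v * d p v) := by
        refine Finset.sum_le_sum fun v hv => ?_
        have a1 : (d l v : ℝ) ≤ 1 + d p v := by exact_mod_cast hd1 v hv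
        have a2 : (d v l : ℝ) ≤ 1 + d p v := by exact_mod_cast hd2 v hv
        have := mul_le_mul_of_nonneg_left a1 (hQ l v).le
        have := mul_le_mul_of_nonneg_left a2 (hQ v l).le
        simp only [hw]; linarith
      have e2 : ∑ v ∈ S, (Q l v * (m l v : ℝ) + Q v l * (m v l : ℝ)) =
          ∑ v ∈ S, (w v + w v * kiteDist (pos p) (pos v)) := by
        refine Finset.sum_congr rfl fun v hv => ?_
        rw [hml v hv, hml' v hv]
        simp only [hw]; push_cast; ring
      simp only [Finset.sum_add_distrib (f := w)] at e1 e2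
      rw [e2, weightedSum_congr hmS]
      linarith
  obtain ⟨pos', h1, h2, h3⟩ := exists_arrangement_of_leaf hQ (i := pos p) hS hcard hinj₁ hlt₁ hp1
    (hlt p hp)
  refine ⟨pos', h1, h2, ?_⟩
  rcases hdm with hdm | hdm
  · rw [weightedSum_congr hdm]
    rcases h3 with h3 | h3
    · exact Or.inl fun u hu v hv => (hdm u hu v hv).trans (h3 u hu v hv)
    · exact Or.inr h3
  · rcases h3 with h3 | h3
    · exact Or.inr (hdm.trans_eq (weightedSum_congr h3))
    · exact Or.inr (hdm.trans h3)

/-- The relabelling of a cycle of length `m` that reads it backwards from the vertex `1`. -/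
def reverseCycle (m a : ℕ) : ℕ := if a = 0 then 1 else if a = 1 then 0 else m + 1 - a

theorem reverseCycle_spec (m a : ℕ) : (a = 0 ∧ reverseCycle m a = 1) ∨
    (a = 1 ∧ reverseCycle m a = 0) ∨ (2 ≤ a ∧ reverseCycle m a = m + 1 - a) := by
  unfold reverseCycle; split_ifs <;> omega

/-- Two kites come from deleting a cycle edge and adding a chord that closes a triangle: one deletes
the edge between positions `S.card - 1` and `0`, the other that between `1` and `2`. A pair
involving `0` or `1` and a position at least `2` has kite distances summing to `S.card - 1`; this
bounds twice the cycle distance because the length is odd. -/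
theorem isKiteDominated_of_odd_cycle {d : V → V → ℕ} {S : Finset V} {pos : V → ℕ}
    (hodd : Odd S.card) (hcard : 3 ≤ S.card) (hinj : Set.InjOn pos S)
    (hlt : ∀ u ∈ S, pos u < S.card) (hd0 : ∀ u ∈ S, d u u = 0)
    (hdpos : ∀ u ∈ S, ∀ v ∈ S, u ≠ v → 0 < d u v)
    (hd1 : ∀ u ∈ S, ∀ v ∈ S, d u v ≤ (pos u - pos v) + (pos v - pos u))
    (hd2 : ∀ u ∈ S, ∀ v ∈ S, d u v + ((pos u - pos v) + (pos v - pos u)) ≤ S.card) :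
    IsKiteDominated d S := by
  intro Q hQ
  rcases hcard.eq_or_lt with h3 | h4
  · refine ⟨pos, hinj, hlt, Or.inl fun u hu v hv => ?_⟩
    by_cases huv : u = v
    · subst huv; simp [hd0 u hu, kiteDist]
    · have a1 := hdpos u hu v hv huv
      have a2 := hd1 u hu v hv
      have a3 := hd2 u hu v hv
      have a4 := hlt u hu
      have a5 := hlt v hv
      have a6 : pos u ≠ pos v := fun h => huv (hinj hu hv h)
      have := kiteDist_spec (pos u) (pos v)
      omega
  · obtain ⟨h, hh⟩ := hodd
    obtain ⟨a, ha, ha'⟩ := exists_mem_pos_eq hinj hlt (a := 1) (by omega)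
    obtain ⟨b, hb, hb'⟩ := exists_mem_pos_eq hinj hlt (a := 2) (by omega)
    -- Strict at positions `1, 2`: deleting their edge puts them `S.card - 2` apart in the second
    -- kite.
    rcases weightedSum_lt_of_convex hQ 1 1 (S := S) (m := d)
      (m₁ := fun u v => kiteDist (pos u) (pos v))
      (m₂ := fun u v => kiteDist (reverseCycle S.card (pos u)) (reverseCycle S.card (pos v)))
      (by
        intro u hu v hv
        have a2 := hd1 u hu v hv
        have a3 := hd2 u hu v hv
        have a4 := hlt u hu
        have a5 := hlt v hv
        have b1 := kiteDist_spec (pos u) (pos v)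
        have b2 := kiteDist_spec (reverseCycle S.card (pos u)) (reverseCycle S.card (pos v))
        have b3 := reverseCycle_spec S.card (pos u)
        have b4 := reverseCycle_spec S.card (pos v)
        rcases b3 with b3 | b3 | b3 <;> rcases b4 with b4 | b4 | b4 <;> omega)
      ⟨a, ha, b, hb, by
        have a2 := hd1 a ha b hb
        have h1 : kiteDist 1 2 = 1 := rfl
        have h2 : kiteDist (reverseCycle S.card 1) (reverseCycle S.card 2) = S.card - 2 := by
          have b2 := kiteDist_spec (reverseCycle S.card 1) (reverseCycle S.card 2)
          have b3 := reverseCycle_spec S.card 1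
          have b4 := reverseCycle_spec S.card 2
          omega
        rw [ha', hb'] at *
        rw [h1, h2]
        omega⟩ with h | h
    · exact ⟨pos, hinj, hlt, Or.inr h⟩
    · refine ⟨fun v => reverseCycle S.card (pos v), fun u hu v hv huv => hinj hu hv ?_, ?_,
        Or.inr h⟩
      · have a4 := hlt u hu
        have a5 := hlt v hv
        have b3 := reverseCycle_spec S.card (pos u)
        have b4 := reverseCycle_spec S.card (pos v)
        dsimp only at huv
        omega
      · intro u hu
        have a4 := hlt u hu
        have b3 := reverseCycle_spec S.card (pos u)
        dsimp only
        omega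

end Domination

/-! ### Growing from the odd cycle to the whole graph -/

section Graph

variable {V : Type*} {G : SimpleGraph V}

theorem dist_getVert_le (hG : G.Connected) {u v : V} (c : G.Walk u v) {i j : ℕ} (hij : i ≤ j)
    (hj : j ≤ c.length) : G.dist (c.getVert i) (c.getVert j) ≤ j - i := by
  induction j, hij using Nat.le_induction with
  | base => simp
  | succ j hij ih =>
    have h1 := ih (by omega)
    have h2 := hG.dist_triangle (u := c.getVert i) (v := c.getVert j) (w := c.getVert (j + 1))
    have h3 := SimpleGraph.dist_eq_one_iff_adj.2 (c.adj_getVert_succ (show j < c.length by omega))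
    omega

theorem isKiteDominated_cycle [DecidableEq V] (hG : G.Connected) {u : V} {c : G.Walk u u}
    (hc : c.IsCycle) (hodd : Odd c.length) :
    IsKiteDominated G.dist ((Finset.range c.length).image c.getVert) := by
  have h3 := hc.three_le_length
  have hinj : Set.InjOn c.getVert (Finset.range c.length) := fun i hi j hj h =>
    hc.getVert_injOn' (by simp at hi ⊢; omega) (by simp at hj ⊢; omega) h
  have hcard : ((Finset.range c.length).image c.getVert).card = c.length := by
    rw [Finset.card_image_of_injOn hinj, Finset.card_range]
  set pos := Function.invFunOn c.getVert (Finset.range c.length : Set ℕ) with hpos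
  have hpos' : ∀ i < c.length, pos (c.getVert i) = i := fun i hi =>
    hinj.leftInvOn_invFunOn (by simpa using hi)
  have key : ∀ i < c.length, ∀ j < c.length,
      G.dist (c.getVert i) (c.getVert j) ≤ (i - j) + (j - i) ∧
      G.dist (c.getVert i) (c.getVert j) + ((i - j) + (j - i)) ≤ c.length := by
    intro i hi j hj
    wlog hij : i ≤ j generalizing i j
    · rw [SimpleGraph.dist_comm, add_comm (i - j)]
      exact this j hj i hi (by omega)
    have h1 := dist_getVert_le hG c hij hj.le
    have h2 := dist_getVert_le hG c (Nat.zero_le i) hi.le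
    have h3 := dist_getVert_le hG c hj.le le_rfl
    -- The complementary arc passes through the base point of the closed walk.
    have h4 := hG.dist_triangle (u := c.getVert i) (v := c.getVert 0) (w := c.getVert j)
    rw [SimpleGraph.dist_comm (u := c.getVert i) (v := c.getVert 0)] at h4
    rw [SimpleGraph.dist_comm, c.getVert_length] at h3
    rw [c.getVert_zero] at h2 h4
    omega
  apply isKiteDominated_of_odd_cycle (pos := pos)
  · rwa [hcard]
  · rwa [hcard]
  · intro a ha b hb hab
    simp only [Finset.coe_image, Set.mem_image, Finset.mem_coe, Finset.mem_range] at ha hb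
    obtain ⟨i, hi, rfl⟩ := ha
    obtain ⟨j, hj, rfl⟩ := hb
    rw [hpos' i hi, hpos' j hj] at hab
    rw [hab]
  · simp only [Finset.forall_mem_image, Finset.mem_range, hcard]
    intro i hi
    rwa [hpos' i hi]
  · simp
  · exact fun a _ b _ hab => hG.pos_dist_of_ne hab
  · simp only [Finset.forall_mem_image, Finset.mem_range]
    intro i hi j hj
    rw [hpos' i hi, hpos' j hj]
    exact (key i hi j hj).1
  · simp only [Finset.forall_mem_image, Finset.mem_range, hcard]
    intro i hi j hj
    rw [hpos' i hi, hpos' j hj]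
    exact (key i hi j hj).2

/-- The distance function of a connected graph with an odd cycle is dominated by that of a kite. -/
theorem isKiteDominated_univ [Fintype V] [DecidableEq V] (hG : G.Connected) {u : V}
    {c : G.Walk u u} (hc : c.IsCycle) (hodd : Odd c.length) :
    IsKiteDominated G.dist Finset.univ := by
  have grow : ∀ m : ℕ, ∀ S : Finset V, Sᶜ.card = m → 3 ≤ S.card → IsKiteDominated G.dist S →
      IsKiteDominated G.dist Finset.univ := by
    intro m
    induction m with
    | zero =>
      intro S hS _ h
      rw [Finset.card_eq_zero, Finset.compl_eq_empty_iff] at hS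
      rwa [hS] at h
    | succ m ih =>
      intro S hS h3 h
      obtain ⟨b, hb⟩ : Sᶜ.Nonempty := Finset.card_pos.1 (by omega)
      obtain ⟨a, ha⟩ : S.Nonempty := Finset.card_pos.1 (by omega)
      obtain ⟨w⟩ := hG a b
      obtain ⟨e, -, he1, he2⟩ := w.exists_boundary_dart (S : Set V) ha (by simpa using hb)
      have hadj := SimpleGraph.dist_eq_one_iff_adj.2 e.adj
      have hl : e.snd ∉ S := he2
      have hd : ∀ v, G.dist e.snd v ≤ 1 + G.dist e.fst v := fun v => by
        have := hG.dist_triangle (u := e.snd) (v := e.fst) (w := v)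
        rw [SimpleGraph.dist_comm (u := e.snd) (v := e.fst)] at this
        omega
      refine ih (insert e.snd S) ?_ ?_ (isKiteDominated_insert h h3 hl he1 SimpleGraph.dist_self
        (fun v _ => hd v) fun v _ => (SimpleGraph.dist_comm (u := v)).trans_le (hd v))
      · rw [Finset.card_compl, Finset.card_insert_of_notMem hl]
        rw [Finset.card_compl] at hS
        omega
      · rw [Finset.card_insert_of_notMem hl]; omega
  refine grow _ _ rfl ?_ (isKiteDominated_cycle hG hc hodd)
  rw [Finset.card_image_of_injOn, Finset.card_range]
  · exact hc.three_le_length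
  · exact fun i hi j hj h => hc.getVert_injOn' (by simp at hi ⊢; omega) (by simp at hj ⊢; omega) h

end Graph

/-! ### Rayleigh bound, positive eigenvector, isomorphism invariance -/

section Spectral

open Matrix

variable {V : Type*} [Fintype V] [DecidableEq V]

theorem posSemidef_radius_sub [Nonempty V] (α : ℝ) (G : SimpleGraph V) :
    (algebraMap ℝ (Matrix V V ℝ) (distAlphaSpectralRadius α G) - distAlphaMatrix α G).PosSemidef := by
  rw [posSemidef_iff_isHermitian_and_spectrum_nonneg]
  refine ⟨?_, ?_⟩
  · refine IsHermitian.sub ?_ (distAlphaMatrix_isHermitian α G)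
    rw [Algebra.algebraMap_eq_smul_one]
    ext i j
    by_cases h : i = j
    · simp [h]
    · simp [h, Ne.symm h]
  · rw [← spectrum.singleton_sub_eq]
    rintro _ ⟨_, rfl, b, hb, rfl⟩
    exact sub_nonneg.2 ((distAlphaSpectralRadius_isGreatest α G).2 hb)

theorem dotProduct_distAlphaMatrix_mulVec (α : ℝ) (G : SimpleGraph V) (x : V → ℝ) :
    x ⬝ᵥ distAlphaMatrix α G *ᵥ x =
      weightedSum Finset.univ (fun u v => α * x u ^ 2 + (1 - α) * (x u * x v)) G.dist := by
  simp only [dotProduct, weightedSum, distAlphaMatrix, add_mulVec, smul_mulVec, Pi.add_apply,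
    Pi.smul_apply, mulVec_diagonal, smul_eq_mul]
  refine Finset.sum_congr rfl fun u _ => ?_
  simp only [mulVec, dotProduct, distMatrix, of_apply, transmission, Finset.mul_sum, Finset.sum_mul,
    mul_add, ← Finset.sum_add_distrib]
  refine Finset.sum_congr rfl fun v _ => ?_
  ring

theorem dotProduct_radius_sub (α : ℝ) (G : SimpleGraph V) (x : V → ℝ) :
    x ⬝ᵥ (algebraMap ℝ (Matrix V V ℝ) (distAlphaSpectralRadius α G) - distAlphaMatrix α G) *ᵥ x =
      distAlphaSpectralRadius α G * (x ⬝ᵥ x) - x ⬝ᵥ distAlphaMatrix α G *ᵥ x := by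
  rw [sub_mulVec, dotProduct_sub, Algebra.algebraMap_eq_smul_one, smul_mulVec, one_mulVec,
    dotProduct_smul, smul_eq_mul]

theorem dotProduct_distAlphaMatrix_mulVec_le [Nonempty V] (α : ℝ) (G : SimpleGraph V)
    (x : V → ℝ) :
    x ⬝ᵥ distAlphaMatrix α G *ᵥ x ≤ distAlphaSpectralRadius α G * (x ⬝ᵥ x) := by
  have := (posSemidef_radius_sub α G).dotProduct_mulVec_nonneg x
  rw [star_trivial, dotProduct_radius_sub] at this
  linarith

theorem distAlphaMatrix_apply_pos {α : ℝ} (hα1 : α < 1) {G : SimpleGraph V} (hG : G.Connected)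
    {u v : V} (huv : u ≠ v) : 0 < distAlphaMatrix α G u v := by
  have : (0 : ℝ) < G.dist u v := by exact_mod_cast hG.pos_dist_of_ne huv
  simp only [distAlphaMatrix, distMatrix, Matrix.add_apply, Matrix.smul_apply, diagonal_apply_ne _ huv, of_apply,
    smul_eq_mul, mul_zero, zero_add]
  exact mul_pos (by linarith) this

/-- A connected graph has a positive vector at which the quadratic form of `D_α(G)` attains its
spectral radius. -/
theorem exists_pos_eigenvector [Nonempty V] {α : ℝ} (hα1 : α < 1)
    {G : SimpleGraph V} (hG : G.Connected) :
    ∃ x : V → ℝ, (∀ v, 0 < x v) ∧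
      x ⬝ᵥ distAlphaMatrix α G *ᵥ x = distAlphaSpectralRadius α G * (x ⬝ᵥ x) := by
  have hmem := (distAlphaSpectralRadius_isGreatest α G).1
  rw [← Matrix.spectrum_toLin', ← Module.End.hasEigenvalue_iff_mem_spectrum] at hmem
  obtain ⟨y, hy⟩ := hmem.exists_hasEigenvector
  have hyA : distAlphaMatrix α G *ᵥ y = distAlphaSpectralRadius α G • y := by
    simpa using hy.apply_eq_smul
  set x : V → ℝ := fun v => |y v| with hx
  have hxx : x ⬝ᵥ x = y ⬝ᵥ y := by simp [hx, dotProduct]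
  have hform : x ⬝ᵥ distAlphaMatrix α G *ᵥ x = distAlphaSpectralRadius α G * (x ⬝ᵥ x) := by
    refine le_antisymm (dotProduct_distAlphaMatrix_mulVec_le α G x) ?_
    -- Replacing `y` by `|y|` keeps the square terms and cannot decrease the products, so the
    -- maximum is still attained.
    rw [hxx, ← smul_eq_mul, ← dotProduct_smul, ← hyA, dotProduct_distAlphaMatrix_mulVec,
      dotProduct_distAlphaMatrix_mulVec]
    refine Finset.sum_le_sum fun u _ => Finset.sum_le_sum fun v _ => ?_
    refine mul_le_mul_of_nonneg_right ?_ (Nat.cast_nonneg _)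
    simp only [hx, sq_abs]
    have h1 : y u * y v ≤ |y u| * |y v| := abs_mul (y u) (y v) ▸ le_abs_self _
    have := mul_le_mul_of_nonneg_left h1 (show 0 ≤ 1 - α by linarith)
    linarith
  -- A zero of a positive semidefinite form lies in the kernel, so `x` is itself an eigenvector.
  have hker := ((posSemidef_radius_sub α G).dotProduct_mulVec_zero_iff x).1 (by
    rw [star_trivial, dotProduct_radius_sub, hform, sub_self])
  have hxA : distAlphaMatrix α G *ᵥ x = distAlphaSpectralRadius α G • x := by
    rw [sub_mulVec, Algebra.algebraMap_eq_smul_one, smul_mulVec, one_mulVec, sub_eq_zero] at hker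
    exact hker.symm
  refine ⟨x, fun v => (abs_nonneg (y v)).lt_of_ne' fun hv => hy.2 ?_, hform⟩
  have hv' : x v = 0 := hv
  -- If `x v = 0`, row `v` of the eigenvalue equation is a vanishing sum of nonnegative terms with
  -- positive off-diagonal coefficients, forcing `y = 0`.
  have hsum : ∑ w, distAlphaMatrix α G v w * x w = 0 := by
    have := congrFun hxA v
    simpa [mulVec, dotProduct, hv'] using this
  have hterm : ∀ w ∈ Finset.univ, 0 ≤ distAlphaMatrix α G v w * x w := by
    intro w _
    by_cases h : v = w
    · rw [← h, hv', mul_zero]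
    · exact mul_nonneg (distAlphaMatrix_apply_pos hα1 hG h).le (abs_nonneg _)
  funext w
  by_cases h : v = w
  · rw [← h]; exact abs_eq_zero.1 hv
  · have := (Finset.sum_eq_zero_iff_of_nonneg hterm).1 hsum w (Finset.mem_univ w)
    rcases mul_eq_zero.1 this with h0 | h0
    · exact absurd h0 (distAlphaMatrix_apply_pos hα1 hG h).ne'
    · exact abs_eq_zero.1 h0

theorem dist_iso {W : Type*} {G : SimpleGraph V} {H : SimpleGraph W} (e : G ≃g H) (u v : V) :
    H.dist (e u) (e v) = G.dist u v := by
  have hr : H.Reachable (e u) (e v) ↔ G.Reachable u v := e.reachable_iff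
  by_cases h : G.Reachable u v
  · obtain ⟨p, hp⟩ := h.exists_walk_length_eq_dist
    obtain ⟨q, hq⟩ := (hr.2 h).exists_walk_length_eq_dist
    apply le_antisymm
    · rw [← hp, ← SimpleGraph.Walk.length_map e.toHom p]
      exact SimpleGraph.dist_le _
    · have := SimpleGraph.dist_le (q.map e.symm.toHom)
      simpa [hq] using this
  · rw [SimpleGraph.dist_eq_zero_of_not_reachable h,
      SimpleGraph.dist_eq_zero_of_not_reachable (mt hr.1 h)]

theorem distAlphaSpectralRadius_congr {W : Type*} [Fintype W] [DecidableEq W] (α : ℝ)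
    {G : SimpleGraph V} {H : SimpleGraph W} (e : G ≃g H) :
    distAlphaSpectralRadius α G = distAlphaSpectralRadius α H := by
  have : distAlphaMatrix α H = reindexAlgEquiv ℝ ℝ e.toEquiv (distAlphaMatrix α G) := by
    ext i j
    obtain ⟨u, rfl⟩ := e.surjective i
    obtain ⟨v, rfl⟩ := e.surjective j
    have ht : transmission H (e u) = transmission G u := by
      simp only [transmission]
      rw [← e.toEquiv.sum_comp]
      exact Finset.sum_congr rfl fun w _ => by rw [← dist_iso e u w]; rfl
    have hsymm : ∀ w, e.toEquiv.symm (e w) = w := e.toEquiv.symm_apply_apply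
    simp [distAlphaMatrix, distMatrix, diagonal_apply, dist_iso, ht, hsymm]
  rw [distAlphaSpectralRadius, distAlphaSpectralRadius, this, AlgEquiv.spectrum_eq]

end Spectral

/-! ### The kite graph: distances and its unique cycle -/

section Kite

theorem kiteGraph_adj {n ω : ℕ} {i j : Fin n} : (kiteGraph n ω).Adj i j ↔ i ≠ j ∧
    ((i.val < ω ∧ j.val < ω) ∨ i.val + 1 = j.val ∨ j.val + 1 = i.val) := Iff.rfl

theorem kiteGraph_three_adj_iff {n : ℕ} {i j : Fin n} :
    (kiteGraph n 3).Adj i j ↔ kiteDist i j = 1 := by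
  have := kiteDist_spec i j
  rw [kiteGraph_adj, ne_eq, Fin.ext_iff]
  omega

theorem kiteGraph_connected {n ω : ℕ} (hn : 0 < n) : (kiteGraph n ω).Connected := by
  have h : ∀ (k : ℕ) (hk : k < n), (kiteGraph n ω).Reachable ⟨0, hn⟩ ⟨k, hk⟩ := by
    intro k
    induction k with
    | zero => exact fun _ => SimpleGraph.Reachable.refl _
    | succ k ih =>
      intro hk
      refine (ih (by omega)).trans (SimpleGraph.Adj.reachable ?_)
      rw [kiteGraph_adj, ne_eq, Fin.ext_iff]
      dsimp only
      omega
  have : Nonempty (Fin n) := ⟨⟨0, hn⟩⟩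
  exact ⟨fun u v => (h u u.2).symm.trans (h v v.2)⟩

/-- `kiteDist` to a fixed vertex changes by at most one along an edge. This inequality suffices for
the spectral comparison. -/
theorem kiteDist_le_dist {n : ℕ} (i j : Fin n) : kiteDist i j ≤ (kiteGraph n 3).dist i j := by
  have h : ∀ {i j : Fin n} (w : (kiteGraph n 3).Walk i j), kiteDist i j ≤ w.length := by
    intro i j w
    induction w with
    | nil => simp [kiteDist]
    | @cons a b c hab w ih =>
      rw [kiteGraph_adj, ne_eq, Fin.ext_iff] at hab
      rw [SimpleGraph.Walk.length_cons]
      have h1 := kiteDist_spec a c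
      have h2 := kiteDist_spec b c
      omega
  obtain ⟨w, hw⟩ := (kiteGraph_connected (ω := 3) (Fin.pos i)).exists_walk_length_eq_dist i j
  exact hw ▸ h w

/-- The largest vertex of a cycle needs two smaller neighbours, but a vertex `m ≥ 3` has only `m -
1`. -/
theorem val_lt_three_of_mem_cycle {n : ℕ} {u : Fin n} {c : (kiteGraph n 3).Walk u u}
    (hc : c.IsCycle) {v : Fin n} (hv : v ∈ c.support) : v.val < 3 := by
  classical
  obtain ⟨m, hm, hmax⟩ := c.support.toFinset.exists_max_image (fun w => w.val)
    ⟨v, List.mem_toFinset.2 hv⟩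
  rw [List.mem_toFinset] at hm
  by_contra! h3
  have hm3 : 3 ≤ m.val := h3.trans (hmax v (List.mem_toFinset.2 hv))
  have hsub : (c.toSubgraph.neighborSet m) ⊆ {⟨m.val - 1, by omega⟩} := by
    intro w hw
    have hw' : c.toSubgraph.Adj m w := hw
    have hadj := kiteGraph_adj.1 hw'.adj_sub
    have hle := hmax w (List.mem_toFinset.2 ((c.mem_verts_toSubgraph).1 hw'.snd_mem))
    simp only [Set.mem_singleton_iff, Fin.ext_iff]
    rw [ne_eq, Fin.ext_iff] at hadj
    omega
  have h1 := Set.ncard_le_ncard hsub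
  rw [hc.ncard_neighborSet_toSubgraph_eq_two hm, Set.ncard_singleton] at h1
  omega

theorem length_eq_three_of_isCycle {n : ℕ} {u : Fin n} {c : (kiteGraph n 3).Walk u u}
    (hc : c.IsCycle) : c.length = 3 ∧ ∀ v : Fin n, v.val < 3 → v ∈ c.support := by
  classical
  have h3 := hc.three_le_length
  have hinj : Set.InjOn (fun i => (c.getVert i).val) (Finset.range c.length) := fun i hi j hj h =>
    hc.getVert_injOn' (by simp at hi ⊢; omega) (by simp at hj ⊢; omega) (Fin.ext h)
  have hsub : (Finset.range c.length).image (fun i => (c.getVert i).val) ⊆ Finset.range 3 := by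
    intro x hx
    obtain ⟨i, -, rfl⟩ := Finset.mem_image.1 hx
    exact Finset.mem_range.2 (val_lt_three_of_mem_cycle hc (c.getVert_mem_support i))
  have hcard : ((Finset.range c.length).image (fun i => (c.getVert i).val)).card = c.length := by
    rw [Finset.card_image_of_injOn hinj, Finset.card_range]
  have hle := Finset.card_le_card hsub
  rw [hcard, Finset.card_range] at hle
  refine ⟨by omega, fun v hv => ?_⟩
  have heq := Finset.eq_of_subset_of_card_le hsub (by rw [hcard, Finset.card_range]; omega)
  obtain ⟨i, -, hi⟩ := Finset.mem_image.1 (heq ▸ Finset.mem_range.2 hv)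
  exact Fin.ext hi ▸ c.getVert_mem_support i

theorem isCycleOf_kiteGraph_eq_induce {n : ℕ} (hn3 : 3 ≤ n) {C : (kiteGraph n 3).Subgraph}
    (hC : IsCycleOf (kiteGraph n 3) C) :
    C = (⊤ : (kiteGraph n 3).Subgraph).induce {v | v.val < 3} := by
  obtain ⟨u, c, hc, rfl⟩ := hC
  obtain ⟨hlen, hmem⟩ := length_eq_three_of_isCycle hc
  have hverts : ∀ v, v ∈ c.support ↔ v.val < 3 :=
    fun v => ⟨val_lt_three_of_mem_cycle hc, hmem v⟩
  ext a b
  · simp [hverts]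
  · rw [SimpleGraph.Subgraph.induce_adj, SimpleGraph.Subgraph.top_adj]
    constructor
    · intro h
      exact ⟨(hverts a).1 ((c.mem_verts_toSubgraph).1 h.fst_mem),
        (hverts b).1 ((c.mem_verts_toSubgraph).1 h.snd_mem), h.adj_sub⟩
    · rintro ⟨ha, hb, hab⟩
      -- `a` has two neighbours in the cycle, all among the other two vertices
      have ha' : a.val < 3 := ha
      have hb' : b.val < 3 := hb
      by_contra hn
      have hne := hab.ne
      obtain ⟨d, hd⟩ : ∃ d : Fin n, c.toSubgraph.neighborSet a ⊆ {d} := by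
        -- The third vertex of the triangle, since the labels sum to `3`.
        refine ⟨⟨3 - a.val - b.val, by have := Fin.val_ne_of_ne hne; omega⟩, fun w hw => ?_⟩
        have hw' : c.toSubgraph.Adj a w := hw
        have hw3 := (hverts w).1 ((c.mem_verts_toSubgraph).1 hw'.snd_mem)
        have hwa := Fin.val_ne_of_ne hw'.adj_sub.ne
        have hwb : w.val ≠ b.val := fun h => hn (Fin.ext h ▸ hw')
        have := Fin.val_ne_of_ne hne
        simp only [Set.mem_singleton_iff, Fin.ext_iff]
        omega
      have h1 := Set.ncard_le_ncard hd
      rw [hc.ncard_neighborSet_toSubgraph_eq_two (hmem a ha'), Set.ncard_singleton] at h1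
      omega

theorem isUnicyclic_kiteGraph {n : ℕ} (hn : 3 ≤ n) : IsUnicyclic (kiteGraph n 3) := by
  refine ⟨kiteGraph_connected (by omega), ?_⟩
  have hadj : ∀ i j : Fin n, i.val < 3 → j.val < 3 → i ≠ j → (kiteGraph n 3).Adj i j :=
    fun i j hi hj h => ⟨h, Or.inl ⟨hi, hj⟩⟩
  let v0 : Fin n := ⟨0, by omega⟩
  let v1 : Fin n := ⟨1, by omega⟩
  let v2 : Fin n := ⟨2, by omega⟩
  have h01 : (kiteGraph n 3).Adj v0 v1 := hadj _ _ (by simp [v0]) (by simp [v1]) (by simp [v0, v1])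
  have h12 : (kiteGraph n 3).Adj v1 v2 := hadj _ _ (by simp [v1]) (by simp [v2]) (by simp [v1, v2])
  have h20 : (kiteGraph n 3).Adj v2 v0 := hadj _ _ (by simp [v2]) (by simp [v0]) (by simp [v2, v0])
  have hcyc : (SimpleGraph.Walk.cons h01 (.cons h12 (.cons h20 .nil))).IsCycle := by
    rw [SimpleGraph.Walk.cons_isCycle_iff]
    simp [SimpleGraph.Walk.cons_isPath_iff, v0, v1, v2]
  have hex : IsCycleOf (kiteGraph n 3) _ := ⟨v0, _, hcyc, rfl⟩
  exact ⟨_, hex, fun C hC =>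
    (isCycleOf_kiteGraph_eq_induce hn hC).trans (isCycleOf_kiteGraph_eq_induce hn hex).symm⟩

theorem isOddCycleGraph_kiteGraph (n : ℕ) : IsOddCycleGraph (kiteGraph n 3) := by
  intro u c hc
  rw [(length_eq_three_of_isCycle hc).1]
  decide

end Kite

/-! ### Transfer to the spectral radius -/

section Main

open Matrix

variable {V : Type*} [Fintype V] [DecidableEq V]

theorem radius_lt_or_iso_kiteGraph {α : ℝ} (hα0 : 0 ≤ α) (hα1 : α < 1) {n : ℕ} (hn : 3 ≤ n)
    {G : SimpleGraph V} (hV : Fintype.card V = n) (hG : IsUnicyclic G) (hodd : IsOddCycleGraph G) :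
    distAlphaSpectralRadius α G < distAlphaSpectralRadius α (kiteGraph n 3) ∨
      Nonempty (G ≃g kiteGraph n 3) := by
  have : Nonempty V := hG.1.nonempty
  have : Nonempty (Fin n) := ⟨⟨0, by omega⟩⟩
  obtain ⟨-, ⟨u, c, hc, -⟩, -⟩ := hG.2
  obtain ⟨x, hx, hform⟩ := exists_pos_eigenvector hα1 hG.1
  obtain ⟨pos, hinj, hlt, hcase⟩ := isKiteDominated_univ hG.1 hc (hodd u c hc)
    (fun u v => α * x u ^ 2 + (1 - α) * (x u * x v)) (fun u v => by
      have h1 := mul_nonneg hα0 (sq_nonneg (x u))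
      have h2 := mul_pos (sub_pos.2 hα1) (mul_pos (hx u) (hx v))
      linarith)
  have hlt' : ∀ v, pos v < n := fun v => by simpa [hV] using hlt v (Finset.mem_univ v)
  let e : V ≃ Fin n := Equiv.ofBijective (fun v => ⟨pos v, hlt' v⟩)
    ((Fintype.bijective_iff_injective_and_card _).2
      ⟨fun u v h => hinj (by simp) (by simp) (Fin.mk.inj h), by simp [hV]⟩)
  rcases hcase with heq | hstrict
  · refine Or.inr ⟨⟨e, fun {u v} => ?_⟩⟩
    -- Adjacency is distance one on both sides, so equal distances give an isomorphism.
    rw [kiteGraph_three_adj_iff, ← SimpleGraph.dist_eq_one_iff_adj,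
      heq u (Finset.mem_univ u) v (Finset.mem_univ v)]
    rfl
  · left
    rw [← dotProduct_distAlphaMatrix_mulVec, hform] at hstrict
    have hK := dotProduct_distAlphaMatrix_mulVec_le α (kiteGraph n 3) (x ∘ e.symm)
    have hnorm : (x ∘ e.symm) ⬝ᵥ (x ∘ e.symm) = x ⬝ᵥ x :=
      e.symm.sum_comp fun v => x v * x v
    have hle : (weightedSum Finset.univ (fun u v => α * x u ^ 2 + (1 - α) * (x u * x v))
        fun u v => kiteDist (pos u) (pos v)) ≤
        (x ∘ e.symm) ⬝ᵥ distAlphaMatrix α (kiteGraph n 3) *ᵥ (x ∘ e.symm) := by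
      rw [dotProduct_distAlphaMatrix_mulVec, weightedSum, weightedSum, ← e.sum_comp]
      refine Finset.sum_le_sum fun u _ => ?_
      rw [← e.sum_comp]
      refine Finset.sum_le_sum fun v _ => ?_
      simp only [Function.comp, Equiv.symm_apply_apply]
      refine mul_le_mul_of_nonneg_left (by exact_mod_cast kiteDist_le_dist (e u) (e v)) ?_
      exact add_nonneg (mul_nonneg hα0 (sq_nonneg _))
        (mul_nonneg (sub_pos.2 hα1).le (mul_pos (hx u) (hx v)).le)
    rw [hnorm] at hK
    have hxx : 0 ≤ x ⬝ᵥ x := Finset.sum_nonneg fun v _ => mul_self_nonneg (x v)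
    exact lt_of_mul_lt_mul_right (hstrict.trans_le (hle.trans hK)) hxx

end Main

theorem mainTheorem4 (α : ℝ) (hα0 : 0 ≤ α) (hα1 : α < 1) (n : ℕ) (hn : 3 ≤ n) :
    -- the extremal graph belongs to the class
    (IsUnicyclic (kiteGraph n 3) ∧ IsOddCycleGraph (kiteGraph n 3)) ∧
    -- it maximizes the distance `α`-spectral radius over the class, and it alone does so
    ∀ {V : Type*} [Fintype V] [DecidableEq V] (G : SimpleGraph V),
      Fintype.card V = n → IsUnicyclic G → IsOddCycleGraph G →
        distAlphaSpectralRadius α G ≤ distAlphaSpectralRadius α (kiteGraph n 3) ∧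
        (distAlphaSpectralRadius α G = distAlphaSpectralRadius α (kiteGraph n 3) ↔
          Nonempty (G ≃g kiteGraph n 3)) := by
  refine ⟨⟨isUnicyclic_kiteGraph hn, isOddCycleGraph_kiteGraph n⟩, fun G hV hG hodd => ?_⟩
  rcases radius_lt_or_iso_kiteGraph hα0 hα1 hn hV hG hodd with h | ⟨⟨e⟩⟩
  · exact ⟨h.le, fun heq => absurd heq h.ne,
      fun ⟨e⟩ => distAlphaSpectralRadius_congr α e⟩
  · have heq := distAlphaSpectralRadius_congr α e
    exact ⟨heq.le, fun _ => ⟨e⟩, fun _ => heq⟩
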